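/- Let $d\in\{1,2,\dots\}$, let $\nu$ be a symmetric L\'evy measure on $\mathbb{R}^d$, i.e. a symmetric Borel measure with $\nu(\{0\})=0$ and $\int\min(1,|y|^2)\,\nu(dy)<\infty$, and put $\Phi(\xi)=\int(1-\cos\langle\xi,y\rangle)\,\nu(dy)$. Let $\{P_t\}_{t\ge 0}$ be the convolution semigroup of probability measures on $\mathbb{R}^d$ with Fourier transforms $\exp(-t\Phi(\xi))$. Let $\alpha\in(0,2)$ and assume that for some $c_0>0$ $$\Phi(\xi)\ge c_0|\xi|^\alpha,\qquad |\xi|>1 .$$ Then for every $t>0$ the measure $P_t$ has a smooth bounded density $p_t$ with respect to Lebesgue measure. Write $B(x,r)$ for the open ball of centre $x$ and radius $r$. Assume further that there are a set $A\subset\mathbb{R}^d$, constants $\gamma\in[1,d]$, $\beta\in[\alpha,2]$, $c_1,c>0$ and a bounded function $q:(0,\infty)\to(0,\infty)$ such that $$\nu(B(x,r))\ge c_1 r^\gamma|x|^{-\alpha-\gamma}q(|x|),\qquad x\in A\setminus\{0\},\ r>0,$$ $$\nu(B(0,r)^c)\le c\,r^{-\beta},\qquad r>0,$$ $$c^{-1}|\xi|^\beta\le\Phi(\xi)\le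 c|\xi|^\beta,\qquad |\xi|\le 1 .$$ Then there is a constant $C>0$, depending only on $d,\alpha,\beta,\gamma,c_0,c_1,c$ and $q$, such that $$p_t(x)\ge C\min\left(t^{-d/\beta},\ t^{1+\frac{\gamma-d}{\beta}}|x|^{-\alpha-\gamma}q(|x|)\right),\qquad x\in A,\ t>1,$$ where for $x=0$ the minimum is read as $t^{-d/\beta}$. -/

import Mathlib

open MeasureTheory
open scoped NNReal ENNReal

noncomputable section

/-- A symmetric Lévy measure on `ℝ^d`. -/
structure IsSymmetricLevyMeasure {d : ℕ} (ν : Measure (EuclideanSpace ℝ (Fin d))) : Prop where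
  zero : ν {0} = 0
  lintegral_lt_top : ∫⁻ y, ENNReal.ofReal (min 1 (‖y‖ ^ 2)) ∂ν < ⊤
  symm : ν.map (fun y => -y) = ν

/-- The Lévy–Khinchin exponent `Φ(ξ) = ∫ (1 - cos ⟨ξ, y⟩) ν(dy)`. The integrand is integrable
for every Lévy measure, since `0 ≤ 1 - cos ⟨ξ, y⟩ ≤ min 2 (‖ξ‖² ‖y‖² / 2)`. -/
def levyExponent {d : ℕ} (ν : Measure (EuclideanSpace ℝ (Fin d)))
    (ξ : EuclideanSpace ℝ (Fin d)) : ℝ :=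
  ∫ y, (1 - Real.cos (inner ℝ ξ y)) ∂ν

/-- `P` is the convolution semigroup of probability measures with Fourier transform
`exp (-t Φ(ξ))`. The last field determines `P`. -/
structure IsLevySemigroup {d : ℕ} (ν : Measure (EuclideanSpace ℝ (Fin d)))
    (P : ℝ≥0 → Measure (EuclideanSpace ℝ (Fin d))) : Prop where
  isProbabilityMeasure : ∀ t, IsProbabilityMeasure (P t)
  conv_add : ∀ s t, P (s + t) = Measure.conv (P s) (P t)
  charFun_eq : ∀ t ξ, charFun (P t) ξ = ((Real.exp (-(t * levyExponent ν ξ)) : ℝ) : ℂ)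

/-- For every `t > 0`, `p t` is the smooth bounded density of `P t` with respect to Lebesgue
measure. By continuity it is determined at every point. -/
def IsSmoothBoundedDensity {d : ℕ} (P : ℝ≥0 → Measure (EuclideanSpace ℝ (Fin d)))
    (p : ℝ≥0 → EuclideanSpace ℝ (Fin d) → ℝ) : Prop :=
  ∀ t, 0 < t →
    ContDiff ℝ (⊤ : ℕ∞) (p t) ∧
    (∀ x, 0 ≤ p t x) ∧
    (∃ M, ∀ x, p t x ≤ M) ∧
    P t = volume.withDensity (fun x => ENNReal.ofReal (p t x))

open Classical in
/-- The function `min (t^(-d/β), t^(1+(γ-d)/β) |x|^(-α-γ) q(|x|))`, where at `x = 0` the second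
term is read as `+∞` (in Lean `0 ^ (-α-γ) = 0`, so the value at `0` is given separately). -/
def largeTimeProfile {d : ℕ} (α β γ : ℝ) (q : ℝ → ℝ) (t : ℝ)
    (x : EuclideanSpace ℝ (Fin d)) : ℝ :=
  if x = 0 then t ^ (-(d : ℝ) / β)
  else min (t ^ (-(d : ℝ) / β)) (t ^ (1 + (γ - d) / β) * ‖x‖ ^ (-α - γ) * q ‖x‖)

end

/-! Put `t = T ^ β`, so that `T` is the spatial scale at time `t`. The density of `P_t` is the
cosine transform of `exp (-t Φ(2πv))`. Growth of `Φ` like `|ξ| ^ α` makes this symbol integrable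
against every power of `|v|`, so the density is smooth and bounded.

Near the origin, the two-sided bound on `Φ` for small `ξ` and the growth for large `ξ` give `tΦ(ξ) ≥
κ ((T|ξ|) ^ α - 1)` everywhere and `tΦ(ξ) ≤ c` for `T|ξ| ≤ 1`. Rescaling by `T` and using `cos u ≥ 1
- |u|` bounds the density below by a multiple of `T ^ (-d) = t ^ (-d/β)` when `|x| ≤ ε₀ T`
(`le_levyKernel_near_zero`, `half_le_levyKernel`).

Away from the origin, cut `tν` at radius `r = ε₀T/2`. The tail bound keeps the mass of the large
jumps below a constant `Λ`, so the compound Poisson law of the large jumps dominates `exp (-Λ)`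
times the large-jump part of `tν`: one large jump lands near `x` (`le_convExp`,
`le_levyKernel_of_one_jump`). Removing these jumps lowers the exponent by at most `2Λ`, so the
near-origin bound persists for the small jumps on a ball of radius `ε₁T`. The product of the two is
of order `T ^ (-d) * t * ν (B(x, ε₁T))`, and the lower bound on `ν` of balls gives the second term
of the minimum.

Discarding all other contributions requires the small-jump density to be nonnegative. This is
obtained by approximation with compound Poisson laws and Gaussian regularisation. -/

/-! ### Convolution exponentials of finite measures. -/

section CompoundPoisson

variable {d : ℕ}

/-- The `k`-fold convolution power of a measure. -/
noncomputable def convPow (ρ : Measure (EuclideanSpace ℝ (Fin d))) :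
    ℕ → Measure (EuclideanSpace ℝ (Fin d))
  | 0 => Measure.dirac 0
  | k + 1 => Measure.conv ρ (convPow ρ k)

variable (ρ : Measure (EuclideanSpace ℝ (Fin d))) [IsFiniteMeasure ρ]

instance isFiniteMeasure_convPow (k : ℕ) : IsFiniteMeasure (convPow ρ k) := by
  induction k with
  | zero => unfold convPow; infer_instance
  | succ k ih => unfold convPow; infer_instance

theorem charFun_convPow (k : ℕ) (ξ : EuclideanSpace ℝ (Fin d)) :
    charFun (convPow ρ k) ξ = charFun ρ ξ ^ k := by
  induction k with
  | zero => simp [convPow, charFun_dirac]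
  | succ k ih => rw [convPow, charFun_conv, ih, pow_succ']

theorem convPow_univ (k : ℕ) :
    convPow ρ k Set.univ = ENNReal.ofReal (ρ.real Set.univ ^ k) := by
  have h := charFun_convPow ρ k 0
  rw [charFun_zero, charFun_zero] at h
  have h' : (convPow ρ k).real Set.univ = ρ.real Set.univ ^ k := by exact_mod_cast h
  rw [← h', ofReal_measureReal]

/-- The exponential `∑ ρ^{*k} / k!` of a finite measure for convolution. -/
noncomputable def convExp (ρ : Measure (EuclideanSpace ℝ (Fin d))) :
    Measure (EuclideanSpace ℝ (Fin d)) :=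
  Measure.sum fun k => ENNReal.ofReal ((k.factorial : ℝ)⁻¹) • convPow ρ k

instance isFiniteMeasure_convExp : IsFiniteMeasure (convExp ρ) := by
  refine ⟨?_⟩
  have h : ∀ k : ℕ, (ENNReal.ofReal ((k.factorial : ℝ)⁻¹) • convPow ρ k) Set.univ
      = ENNReal.ofReal (ρ.real Set.univ ^ k / k.factorial) := fun k => by
    rw [Measure.smul_apply, convPow_univ, smul_eq_mul, ← ENNReal.ofReal_mul (by positivity)]
    congr 1
    rw [mul_comm, div_eq_mul_inv]
  rw [convExp, Measure.sum_apply _ MeasurableSet.univ, tsum_congr h,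
    ← ENNReal.ofReal_tsum_of_nonneg (fun k => by positivity)
      (Real.summable_pow_div_factorial _)]
  exact ENNReal.ofReal_lt_top

/-- Keeps only the term `k = 1` of the series; this is the single large jump of the main estimate.
-/
theorem le_convExp : ρ ≤ convExp ρ := by
  have h : ENNReal.ofReal (((1 : ℕ).factorial : ℝ)⁻¹) • convPow ρ 1 = ρ := by
    simp [convPow]
  calc ρ = _ := h.symm
    _ ≤ convExp ρ := Measure.le_sum (fun k : ℕ =>
        ENNReal.ofReal ((k.factorial : ℝ)⁻¹) • convPow ρ k) 1

theorem integrable_cexp_inner (μ : Measure (EuclideanSpace ℝ (Fin d))) [IsFiniteMeasure μ]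
    (ξ : EuclideanSpace ℝ (Fin d)) :
    Integrable (fun x => Complex.exp ((inner ℝ x ξ : ℝ) * Complex.I)) μ := by
  refine Integrable.of_bound (C := 1) (by fun_prop) (ae_of_all _ fun x => ?_)
  rw [Complex.norm_exp_ofReal_mul_I]

/-- Convolution powers become powers of the characteristic function, and integration against a sum
of measures is termwise, which leaves the exponential series. -/
theorem charFun_convExp (ξ : EuclideanSpace ℝ (Fin d)) :
    charFun (convExp ρ) ξ = Complex.exp (charFun ρ ξ) := by
  have h := hasSum_integral_measure (μ := fun k : ℕ =>
    ENNReal.ofReal ((k.factorial : ℝ)⁻¹) • convPow ρ k)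
    (f := fun x => Complex.exp ((inner ℝ x ξ : ℝ) * Complex.I))
    (integrable_cexp_inner (convExp ρ) ξ)
  have h2 : ∀ k : ℕ, ∫ x, Complex.exp ((inner ℝ x ξ : ℝ) * Complex.I)
      ∂(ENNReal.ofReal ((k.factorial : ℝ)⁻¹) • convPow ρ k)
      = (k.factorial : ℂ)⁻¹ * charFun ρ ξ ^ k := fun k => by
    rw [integral_smul_measure, ← charFun_apply, charFun_convPow,
      ENNReal.toReal_ofReal (by positivity), Complex.real_smul]
    push_cast
    rfl
  simp only [h2] at h
  rw [charFun_apply]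
  refine HasSum.unique h ?_
  have := NormedSpace.expSeries_div_hasSum_exp (charFun ρ ξ)
  rw [← Complex.exp_eq_exp_ℂ] at this
  simpa only [div_eq_inv_mul] using this

end CompoundPoisson

/-! ### The Lévy–Khinchin exponent and its splitting into small and large jumps. -/

section LevyExponent

variable {d : ℕ} {ν : Measure (EuclideanSpace ℝ (Fin d))}

theorem one_sub_cos_inner_nonneg (ξ y : EuclideanSpace ℝ (Fin d)) :
    0 ≤ 1 - Real.cos (inner ℝ ξ y) := by
  linarith [Real.cos_le_one (inner ℝ ξ y)]

/-- The constant adds the bounds for large and small `y`. Being increasing in `‖ξ‖`, it gives a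
dominating function that is uniform for `ξ` in bounded sets. -/
theorem one_sub_cos_inner_le (ξ y : EuclideanSpace ℝ (Fin d)) :
    1 - Real.cos (inner ℝ ξ y) ≤ (2 + ‖ξ‖ ^ 2) * min 1 (‖y‖ ^ 2) := by
  have h1 := Real.neg_one_le_cos (inner ℝ ξ y)
  have h2 := Real.one_sub_sq_div_two_le_cos (x := inner ℝ ξ y)
  have h3 : (inner ℝ ξ y : ℝ) ^ 2 ≤ ‖ξ‖ ^ 2 * ‖y‖ ^ 2 := by
    rw [← mul_pow, ← sq_abs]
    gcongr
    exact abs_real_inner_le_norm ξ y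
  rcases le_total 1 (‖y‖ ^ 2) with h | h
  · rw [min_eq_left h]; nlinarith [sq_nonneg ‖ξ‖]
  · rw [min_eq_right h]; nlinarith [sq_nonneg ‖ξ‖, sq_nonneg ‖y‖]

theorem IsSymmetricLevyMeasure.integrable_min (hν : IsSymmetricLevyMeasure ν) :
    Integrable (fun y => min 1 (‖y‖ ^ 2)) ν := by
  refine ⟨by fun_prop, ?_⟩
  rw [hasFiniteIntegral_iff_ofReal (ae_of_all _ fun y => by positivity)]
  exact hν.lintegral_lt_top

theorem IsSymmetricLevyMeasure.integrable_one_sub_cos (hν : IsSymmetricLevyMeasure ν)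
    (ξ : EuclideanSpace ℝ (Fin d)) : Integrable (fun y => 1 - Real.cos (inner ℝ ξ y)) ν := by
  refine (hν.integrable_min.const_mul (2 + ‖ξ‖ ^ 2)).mono' (by fun_prop) (ae_of_all _ fun y => ?_)
  rw [Real.norm_of_nonneg (one_sub_cos_inner_nonneg ξ y)]
  exact one_sub_cos_inner_le ξ y

theorem levyExponent_nonneg (ν : Measure (EuclideanSpace ℝ (Fin d)))
    (ξ : EuclideanSpace ℝ (Fin d)) : 0 ≤ levyExponent ν ξ :=
  integral_nonneg fun y => one_sub_cos_inner_nonneg ξ y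

theorem levyExponent_zero (ν : Measure (EuclideanSpace ℝ (Fin d))) : levyExponent ν 0 = 0 := by
  simp [levyExponent]

theorem levyExponent_neg (ν : Measure (EuclideanSpace ℝ (Fin d)))
    (ξ : EuclideanSpace ℝ (Fin d)) : levyExponent ν (-ξ) = levyExponent ν ξ := by
  simp [levyExponent]

theorem IsSymmetricLevyMeasure.continuous_levyExponent (hν : IsSymmetricLevyMeasure ν) :
    Continuous (levyExponent ν) := by
  rw [continuous_iff_continuousAt]
  intro ξ₀
  refine continuousAt_of_dominated
    (bound := fun y => (2 + (‖ξ₀‖ + 1) ^ 2) * min 1 (‖y‖ ^ 2))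
    (Filter.Eventually.of_forall fun ξ => by fun_prop) ?_
    (hν.integrable_min.const_mul _) (ae_of_all _ fun y => by fun_prop)
  filter_upwards [Metric.ball_mem_nhds ξ₀ one_pos] with ξ hξ
  refine ae_of_all _ fun y => ?_
  rw [Real.norm_of_nonneg (one_sub_cos_inner_nonneg ξ y)]
  refine (one_sub_cos_inner_le ξ y).trans ?_
  have h : ‖ξ‖ ≤ ‖ξ₀‖ + 1 := by
    have h1 := norm_le_norm_add_norm_sub' ξ ξ₀
    rw [mem_ball_iff_norm] at hξ
    linarith
  gcongr

theorem levyExponent_smul (t : ℝ≥0) (ξ : EuclideanSpace ℝ (Fin d)) :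
    levyExponent (t • ν) ξ = t * levyExponent ν ξ := by
  rw [levyExponent, integral_smul_nnreal_measure]
  rfl

theorem IsSymmetricLevyMeasure.smul (hν : IsSymmetricLevyMeasure ν) (t : ℝ≥0) :
    IsSymmetricLevyMeasure (t • ν) where
  zero := by simp [hν.zero]
  lintegral_lt_top := by
    rw [lintegral_smul_measure]
    exact ENNReal.mul_lt_top ENNReal.coe_lt_top hν.lintegral_lt_top
  symm := by rw [Measure.map_smul, hν.symm]

theorem IsSymmetricLevyMeasure.restrict (hν : IsSymmetricLevyMeasure ν)
    {s : Set (EuclideanSpace ℝ (Fin d))} (hs : MeasurableSet s) (hsymm : -s = s) :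
    IsSymmetricLevyMeasure (ν.restrict s) where
  zero := le_antisymm ((Measure.restrict_apply_le _ _).trans hν.zero.le) bot_le
  lintegral_lt_top :=
    (lintegral_mono' Measure.restrict_le_self le_rfl).trans_lt hν.lintegral_lt_top
  symm := by
    have h := Measure.restrict_map (μ := ν) (measurable_neg (G := EuclideanSpace ℝ (Fin d))) hs
    have h2 : (fun y : EuclideanSpace ℝ (Fin d) => -y) ⁻¹' s = s := hsymm
    change ((ν.map (fun y => -y)).restrict s) = _ at h
    rw [hν.symm] at h
    change _ = (ν.restrict ((fun y : EuclideanSpace ℝ (Fin d) => -y) ⁻¹' s)).map (fun y => -y) at h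
    rw [h2] at h
    exact h.symm

theorem neg_ball_zero (r : ℝ) :
    -(Metric.ball (0 : EuclideanSpace ℝ (Fin d)) r) = Metric.ball 0 r := by
  ext x; simp

theorem IsSymmetricLevyMeasure.restrict_ball (hν : IsSymmetricLevyMeasure ν) (r : ℝ) :
    IsSymmetricLevyMeasure (ν.restrict (Metric.ball 0 r)) :=
  hν.restrict measurableSet_ball (neg_ball_zero r)

theorem IsSymmetricLevyMeasure.restrict_compl_ball (hν : IsSymmetricLevyMeasure ν) (r : ℝ) :
    IsSymmetricLevyMeasure (ν.restrict (Metric.ball 0 r)ᶜ) :=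
  hν.restrict measurableSet_ball.compl (by rw [Set.compl_neg, neg_ball_zero])

theorem IsSymmetricLevyMeasure.isFiniteMeasure_restrict_compl_ball
    (hν : IsSymmetricLevyMeasure ν) {r : ℝ} (hr : 0 < r) :
    IsFiniteMeasure (ν.restrict (Metric.ball 0 r)ᶜ) := by
  refine ⟨?_⟩
  rw [Measure.restrict_apply_univ]
  have hm : 0 < min 1 (r ^ 2) := by positivity
  refine (measure_mono ?_).trans_lt (hν.integrable_min.measure_ge_lt_top hm)
  intro y hy
  have hy' : r ≤ ‖y‖ := by simpa using hy
  exact min_le_min le_rfl (pow_le_pow_left₀ hr.le hy' 2)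

theorem IsSymmetricLevyMeasure.levyExponent_add_compl (hν : IsSymmetricLevyMeasure ν)
    {s : Set (EuclideanSpace ℝ (Fin d))} (hs : MeasurableSet s)
    (ξ : EuclideanSpace ℝ (Fin d)) :
    levyExponent (ν.restrict s) ξ + levyExponent (ν.restrict sᶜ) ξ = levyExponent ν ξ :=
  integral_add_compl hs (hν.integrable_one_sub_cos ξ)

/-- Controls how much the exponent can drop when a finite part of the Lévy measure is removed. -/
theorem levyExponent_le_two_mul [IsFiniteMeasure ν] (ξ : EuclideanSpace ℝ (Fin d)) :
    levyExponent ν ξ ≤ 2 * ν.real Set.univ := by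
  have : levyExponent ν ξ ≤ ∫ _, (2 : ℝ) ∂ν := by
    refine integral_mono_of_nonneg (ae_of_all _ fun y => one_sub_cos_inner_nonneg ξ y)
      (integrable_const _) (ae_of_all _ fun y => ?_)
    have := Real.neg_one_le_cos (inner ℝ ξ y)
    dsimp only
    linarith
  simpa [mul_comm] using this

/-- Symmetry makes the characteristic function equal to its conjugate, so only the cosine part
remains. -/
theorem IsSymmetricLevyMeasure.charFun_eq [IsFiniteMeasure ν] (hν : IsSymmetricLevyMeasure ν)
    (ξ : EuclideanSpace ℝ (Fin d)) :
    charFun ν ξ = ((ν.real Set.univ - levyExponent ν ξ : ℝ) : ℂ) := by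
  have him : (charFun ν ξ).im = 0 := by
    have h : charFun ν (-ξ) = charFun ν ξ := by
      conv_rhs => rw [← hν.symm]
      rw [charFun_apply, charFun_apply, integral_map (by fun_prop) (by fun_prop)]
      simp
    rw [charFun_neg] at h
    exact Complex.conj_eq_iff_im.1 h
  have hcos : Integrable (fun y => Real.cos (inner ℝ ξ y)) ν :=
    Integrable.of_bound (C := 1) (by fun_prop) (ae_of_all _ fun y => Real.abs_cos_le_one _)
  have hre : (charFun ν ξ).re = ν.real Set.univ - levyExponent ν ξ := by
    rw [levyExponent, integral_sub (integrable_const _) hcos, charFun_apply]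
    have := integral_re (𝕜 := ℂ) (integrable_cexp_inner ν ξ)
    simp only [RCLike.re_eq_complex_re, Complex.exp_ofReal_mul_I_re] at this
    rw [← this]
    simp [real_inner_comm]
  apply Complex.ext
  · rw [Complex.ofReal_re, hre]
  · rw [Complex.ofReal_im, him]

theorem IsSymmetricLevyMeasure.charFun_convExp_eq [IsFiniteMeasure ν]
    (hν : IsSymmetricLevyMeasure ν) (ξ : EuclideanSpace ℝ (Fin d)) :
    charFun (convExp ν) ξ = ((Real.exp (ν.real Set.univ - levyExponent ν ξ) : ℝ) : ℂ) := by
  rw [charFun_convExp, hν.charFun_eq, Complex.ofReal_exp]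

end LevyExponent

/-! ### The Fourier cosine transform: convolution, duality, Gaussians and inversion. -/

section CosTransform

open scoped FourierTransform

variable {d : ℕ} {h g : EuclideanSpace ℝ (Fin d) → ℝ}

/-- The Fourier cosine transform `∫ cos (2π ⟨v, x⟩) h(v) dv`. -/
noncomputable def cosTransform (h : EuclideanSpace ℝ (Fin d) → ℝ)
    (x : EuclideanSpace ℝ (Fin d)) : ℝ :=
  ∫ v, Real.cos (2 * Real.pi * inner ℝ v x) * h v

theorem integrable_cos_mul (hh : Integrable h) (x : EuclideanSpace ℝ (Fin d)) :
    Integrable (fun v => Real.cos (2 * Real.pi * inner ℝ v x) * h v) := by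
  refine hh.mono (AEStronglyMeasurable.mul (by fun_prop) hh.1) (ae_of_all _ fun v => ?_)
  rw [norm_mul]
  exact mul_le_of_le_one_left (norm_nonneg _) (Real.abs_cos_le_one _)

theorem abs_cosTransform_le (h : EuclideanSpace ℝ (Fin d) → ℝ) (hh : Integrable h)
    (x : EuclideanSpace ℝ (Fin d)) : |cosTransform h x| ≤ ∫ v, |h v| := by
  refine (norm_integral_le_integral_norm _).trans
    (integral_mono (integrable_cos_mul hh x).norm hh.abs fun v => ?_)
  simp only [norm_mul, Real.norm_eq_abs]
  exact mul_le_of_le_one_left (abs_nonneg _) (Real.abs_cos_le_one _)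

theorem continuous_cosTransform (hh : Integrable h) : Continuous (cosTransform h) := by
  refine continuous_of_dominated (bound := fun v => |h v|)
    (fun x => (integrable_cos_mul hh x).1) (fun x => ae_of_all _ fun v => ?_) hh.abs
    (ae_of_all _ fun v => by fun_prop)
  simp only [norm_mul, Real.norm_eq_abs]
  exact mul_le_of_le_one_left (abs_nonneg _) (Real.abs_cos_le_one _)

/-- The sine part of the Fourier integral is odd and integrates to zero. -/
theorem fourier_ofReal_eq_cosTransform (hh : Integrable h) (heven : ∀ v, h (-v) = h v)
    (x : EuclideanSpace ℝ (Fin d)) :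
    𝓕 (fun v => (h v : ℂ)) x = (cosTransform h x : ℂ) := by
  have hint : Integrable (fun v => Complex.exp ((-(2 * Real.pi * inner ℝ v x) : ℝ) * Complex.I)
      * (h v : ℂ)) := by
    refine hh.ofReal (𝕜 := ℂ) |>.mono
      (AEStronglyMeasurable.mul (by fun_prop) hh.ofReal.1) (ae_of_all _ fun v => ?_)
    rw [norm_mul, Complex.norm_exp_ofReal_mul_I, one_mul]
    rfl
  have hF : 𝓕 (fun v => (h v : ℂ)) x
      = ∫ v, Complex.exp ((-(2 * Real.pi * inner ℝ v x) : ℝ) * Complex.I) * (h v : ℂ) := by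
    rw [Real.fourier_eq']
    refine integral_congr_ae (ae_of_all _ fun v => ?_)
    simp
  rw [hF]
  apply Complex.ext
  · have := integral_re (𝕜 := ℂ) hint
    simp only [RCLike.re_eq_complex_re] at this
    rw [← this, Complex.ofReal_re]
    refine integral_congr_ae (ae_of_all _ fun v => ?_)
    dsimp only
    rw [Complex.re_mul_ofReal, Complex.exp_ofReal_mul_I_re, Real.cos_neg]
  · have := integral_im (𝕜 := ℂ) hint
    simp only [RCLike.im_eq_complex_im] at this
    rw [← this, Complex.ofReal_im]
    have hodd := integral_neg_eq_self (μ := (volume : Measure (EuclideanSpace ℝ (Fin d))))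
      (fun v => (Complex.exp ((-(2 * Real.pi * inner ℝ v x) : ℝ) * Complex.I) * (h v : ℂ)).im)
    have hneg : ∀ v : EuclideanSpace ℝ (Fin d),
        (Complex.exp ((-(2 * Real.pi * inner ℝ (-v) x) : ℝ) * Complex.I) * (h (-v) : ℂ)).im
        = -(Complex.exp ((-(2 * Real.pi * inner ℝ v x) : ℝ) * Complex.I) * (h v : ℂ)).im := by
      intro v
      rw [Complex.im_mul_ofReal, Complex.im_mul_ofReal, Complex.exp_ofReal_mul_I_im,
        Complex.exp_ofReal_mul_I_im, heven, inner_neg_left]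
      simp
    simp only [hneg, integral_neg] at hodd
    linarith

/-- Multiply the characteristic function by `exp (-ia)` and take real parts; since it is real, no
sine term appears. -/
theorem integral_cos_sub_inner {M : Measure (EuclideanSpace ℝ (Fin d))} [IsFiniteMeasure M]
    {ξ : EuclideanSpace ℝ (Fin d)} {m : ℝ} (hM : charFun M ξ = (m : ℂ)) (a : ℝ) :
    ∫ y, Real.cos (a - inner ℝ y ξ) ∂M = Real.cos a * m := by
  have hint := (integrable_cexp_inner M ξ).const_mul (Complex.exp (((-a : ℝ) : ℂ) * Complex.I))
  have h1 := integral_re (𝕜 := ℂ) hint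
  rw [integral_const_mul, ← charFun_apply, hM] at h1
  simp only [RCLike.re_eq_complex_re] at h1
  rw [Complex.re_mul_ofReal, Complex.exp_ofReal_mul_I_re, Real.cos_neg] at h1
  rw [← h1]
  refine integral_congr_ae (ae_of_all _ fun y => ?_)
  dsimp only
  rw [← Complex.exp_add, ← add_mul, ← Complex.ofReal_add, Complex.exp_ofReal_mul_I_re,
    ← Real.cos_neg]
  congr 1
  ring

/-- The cosine transform maps a product with a real characteristic function to a convolution. -/
theorem integral_cosTransform_sub {M : Measure (EuclideanSpace ℝ (Fin d))} [IsFiniteMeasure M]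
    {m : EuclideanSpace ℝ (Fin d) → ℝ}
    (hM : ∀ v, charFun M ((2 * Real.pi) • v) = (m v : ℂ)) (hh : Integrable h)
    (x : EuclideanSpace ℝ (Fin d)) :
    ∫ y, cosTransform h (x - y) ∂M = cosTransform (fun v => m v * h v) x := by
  have hint : Integrable (fun p : EuclideanSpace ℝ (Fin d) × EuclideanSpace ℝ (Fin d) =>
      Real.cos (2 * Real.pi * inner ℝ p.2 (x - p.1)) * h p.2) (M.prod volume) := by
    have h2 : Integrable (fun p : EuclideanSpace ℝ (Fin d) × EuclideanSpace ℝ (Fin d) => h p.2)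
      (M.prod volume) := hh.comp_snd M
    refine h2.mono (AEStronglyMeasurable.mul (by fun_prop) h2.1) (ae_of_all _ fun p => ?_)
    rw [norm_mul]
    exact mul_le_of_le_one_left (norm_nonneg _) (Real.abs_cos_le_one _)
  unfold cosTransform
  rw [integral_integral_swap hint]
  refine integral_congr_ae (ae_of_all _ fun v => ?_)
  dsimp only
  rw [integral_mul_const, ← mul_assoc]
  congr 1
  rw [← integral_cos_sub_inner (hM v)]
  refine integral_congr_ae (ae_of_all _ fun y => ?_)
  dsimp only
  rw [inner_sub_right, inner_smul_right, real_inner_comm v y]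
  congr 1
  ring

/-- Fubini with the symmetric kernel `cos (2π ⟨v, x⟩)`. -/
theorem integral_cosTransform_mul (hh : Integrable h) (hg : Integrable g) :
    ∫ x, cosTransform h x * g x = ∫ v, h v * cosTransform g v := by
  have hint : Integrable (fun p : EuclideanSpace ℝ (Fin d) × EuclideanSpace ℝ (Fin d) =>
      Real.cos (2 * Real.pi * inner ℝ p.2 p.1) * h p.2 * g p.1) (volume.prod volume) := by
    have h2 := (hg.mul_prod hh)
    refine h2.mono ?_ (ae_of_all _ fun p => ?_)
    · simp_rw [mul_assoc, mul_comm (h _) (g _)]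
      exact AEStronglyMeasurable.mul (by fun_prop) h2.1
    · rw [mul_assoc, norm_mul, mul_comm (h _)]
      exact mul_le_of_le_one_left (norm_nonneg _) (Real.abs_cos_le_one _)
  unfold cosTransform
  simp_rw [← integral_mul_const, ← integral_const_mul]
  rw [integral_integral_swap hint]
  refine integral_congr_ae (ae_of_all _ fun v => integral_congr_ae (ae_of_all _ fun x => ?_))
  dsimp only
  rw [real_inner_comm]
  ring

theorem integrable_exp_neg_mul_sq_norm {b : ℝ} (hb : 0 < b) :
    Integrable (fun v : EuclideanSpace ℝ (Fin d) => Real.exp (-b * ‖v‖ ^ 2)) := by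
  have := GaussianFourier.integrable_cexp_neg_mul_sq_norm_add (V := EuclideanSpace ℝ (Fin d))
    (b := (b : ℂ)) (by simpa using hb) 0 0
  refine this.norm.congr (ae_of_all _ fun v => ?_)
  simp only [Complex.norm_exp]
  congr 1
  simp [← Complex.ofReal_pow]

theorem cosTransform_exp_neg_mul_sq_norm {b : ℝ} (hb : 0 < b) (w : EuclideanSpace ℝ (Fin d)) :
    cosTransform (fun v => Real.exp (-b * ‖v‖ ^ 2)) w
      = (Real.pi / b) ^ ((d : ℝ) / 2) * Real.exp (-(Real.pi ^ 2 / b) * ‖w‖ ^ 2) := by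
  have h1 := fourier_ofReal_eq_cosTransform (integrable_exp_neg_mul_sq_norm (d := d) hb)
    (by simp) w
  have h2 := fourier_gaussian_innerProductSpace (V := EuclideanSpace ℝ (Fin d))
    (b := (b : ℂ)) (by simpa using hb) w
  rw [← Complex.ofReal_inj, ← h1]
  push_cast
  rw [h2, Complex.ofReal_cpow (by positivity)]
  simp only [finrank_euclideanSpace, Fintype.card_fin]
  push_cast
  congr 2
  ring

theorem cosTransform_exp_neg_mul_sq_norm_nonneg {b : ℝ} (hb : 0 < b)
    (w : EuclideanSpace ℝ (Fin d)) :
    0 ≤ cosTransform (fun v => Real.exp (-b * ‖v‖ ^ 2)) w := by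
  rw [cosTransform_exp_neg_mul_sq_norm hb]
  have := Real.pi_pos
  positivity

theorem integrable_cosTransform_exp_neg_mul_sq_norm {b : ℝ} (hb : 0 < b) :
    Integrable (cosTransform (d := d) (fun v => Real.exp (-b * ‖v‖ ^ 2))) := by
  have h : cosTransform (d := d) (fun v => Real.exp (-b * ‖v‖ ^ 2)) = _ :=
    funext (cosTransform_exp_neg_mul_sq_norm hb)
  rw [h]
  have := Real.pi_pos
  exact (integrable_exp_neg_mul_sq_norm (by positivity)).const_mul _

theorem integral_cosTransform_exp_neg_mul_sq_norm {b : ℝ} (hb : 0 < b) :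
    ∫ w : EuclideanSpace ℝ (Fin d), cosTransform (fun v => Real.exp (-b * ‖v‖ ^ 2)) w = 1 := by
  have hpi := Real.pi_pos
  simp_rw [cosTransform_exp_neg_mul_sq_norm hb]
  rw [integral_const_mul, GaussianFourier.integral_rexp_neg_mul_sq_norm (by positivity),
    finrank_euclideanSpace, Fintype.card_fin, ← Real.mul_rpow (by positivity) (by positivity)]
  have : Real.pi / b * (Real.pi / (Real.pi ^ 2 / b)) = 1 := by field_simp
  rw [this, Real.one_rpow]

/-- A nonnegative cosine transform of an integrable function bounded by one is integrable. -/
theorem integrable_cosTransform (hh : Integrable h) (hle : ∀ v, h v ≤ 1)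
    (hpos : ∀ x, 0 ≤ cosTransform h x) : Integrable (cosTransform h) := by
  have hcont := continuous_cosTransform hh
  -- Duality moves the transform onto the Gaussian, whose transform is nonnegative with total mass
  -- one; `h ≤ 1` then gives a bound independent of `b`.
  have key : ∀ b : ℝ, 0 < b → ∫⁻ x, ENNReal.ofReal (cosTransform h x * Real.exp (-b * ‖x‖ ^ 2))
      ≤ 1 := by
    intro b hb
    have hG := integrable_exp_neg_mul_sq_norm (d := d) hb
    have hint : Integrable (fun x => cosTransform h x * Real.exp (-b * ‖x‖ ^ 2)) := by
      refine (hG.const_mul (∫ v, |h v|)).mono' (by fun_prop) (ae_of_all _ fun x => ?_)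
      rw [norm_mul, Real.norm_eq_abs, Real.norm_of_nonneg (Real.exp_nonneg _)]
      gcongr
      exact abs_cosTransform_le h hh x
    rw [← ofReal_integral_eq_lintegral_ofReal hint
      (ae_of_all _ fun x => mul_nonneg (hpos x) (Real.exp_nonneg _)),
      integral_cosTransform_mul hh hG, ← ENNReal.ofReal_one]
    apply ENNReal.ofReal_le_ofReal
    rw [← integral_cosTransform_exp_neg_mul_sq_norm (d := d) hb]
    have hGi := integrable_cosTransform_exp_neg_mul_sq_norm (d := d) hb
    have hbd : Integrable (fun v => h v * cosTransform (fun v => Real.exp (-b * ‖v‖ ^ 2)) v) := by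
      refine (hh.mul_const (∫ v : EuclideanSpace ℝ (Fin d), |Real.exp (-b * ‖v‖ ^ 2)|)).mono
        (hh.1.mul hGi.1) (ae_of_all _ fun v => ?_)
      rw [norm_mul, norm_mul]
      gcongr
      exact (abs_cosTransform_le _ hG v).trans (le_abs_self _)
    refine integral_mono hbd hGi fun v => ?_
    exact mul_le_of_le_one_left (cosTransform_exp_neg_mul_sq_norm_nonneg hb v) (hle v)
  refine ⟨hcont.aestronglyMeasurable, ?_⟩
  rw [hasFiniteIntegral_iff_ofReal (ae_of_all _ hpos)]
  -- Fatou's lemma along `b = 1 / (n + 1)` removes the Gaussian weight.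
  have hlim : ∀ x, Filter.liminf (fun n : ℕ => ENNReal.ofReal
      (cosTransform h x * Real.exp (-(1 / ((n : ℝ) + 1)) * ‖x‖ ^ 2))) Filter.atTop
      = ENNReal.ofReal (cosTransform h x) := by
    intro x
    apply Filter.Tendsto.liminf_eq
    apply ENNReal.tendsto_ofReal
    have h0 := ((tendsto_one_div_add_atTop_nhds_zero_nat (𝕜 := ℝ)).neg.mul_const (‖x‖ ^ 2))
    rw [neg_zero, zero_mul] at h0
    simpa using ((Real.continuous_exp.tendsto 0).comp h0).const_mul (cosTransform h x)
  calc ∫⁻ x, ENNReal.ofReal (cosTransform h x)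
      = ∫⁻ x, Filter.liminf (fun n : ℕ => ENNReal.ofReal
        (cosTransform h x * Real.exp (-(1 / ((n : ℝ) + 1)) * ‖x‖ ^ 2))) Filter.atTop := by
        simp_rw [hlim]
    _ ≤ Filter.liminf (fun n : ℕ => ∫⁻ x, ENNReal.ofReal
        (cosTransform h x * Real.exp (-(1 / ((n : ℝ) + 1)) * ‖x‖ ^ 2))) Filter.atTop :=
        lintegral_liminf_le fun n => by fun_prop
    _ ≤ 1 := by
        refine Filter.liminf_le_of_frequently_le'
          (Filter.Frequently.of_forall fun n => key _ (by positivity))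
    _ < ⊤ := ENNReal.one_lt_top

/-- Fourier inversion: the measure with density `cosTransform h` has characteristic function
`h (ξ / 2π)`. -/
theorem charFun_withDensity_cosTransform (hcont : Continuous h) (hh : Integrable h)
    (heven : ∀ v, h (-v) = h v) (hpos : ∀ x, 0 ≤ cosTransform h x)
    (hint : Integrable (cosTransform h)) (v : EuclideanSpace ℝ (Fin d)) :
    charFun (volume.withDensity fun x => ENNReal.ofReal (cosTransform h x))
      ((2 * Real.pi) • v) = (h v : ℂ) := by
  have hF : 𝓕 (fun v => (h v : ℂ)) = fun x => (cosTransform h x : ℂ) :=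
    funext (fourier_ofReal_eq_cosTransform hh heven)
  have hinv := Continuous.fourierInv_fourier_eq (f := fun v => (h v : ℂ)) (by fun_prop)
    hh.ofReal (by rw [hF]; exact hint.ofReal)
  rw [hF] at hinv
  have hv := congrFun hinv v
  rw [← hv, Real.fourierInv_eq', charFun_apply]
  have hmeas : Measurable (cosTransform h) := (continuous_cosTransform hh).measurable
  rw [integral_withDensity_eq_integral_toReal_smul (by fun_prop)
    (ae_of_all _ fun x => ENNReal.ofReal_lt_top)]
  refine integral_congr_ae (ae_of_all _ fun x => ?_)
  dsimp only
  rw [ENNReal.toReal_ofReal (hpos x), Complex.real_smul, smul_eq_mul, mul_comm, inner_smul_right]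

end CosTransform

/-! ### Infinitely divisible densities, their positivity and the one-jump bound. -/

section LevyKernel

variable {d : ℕ} {ν : Measure (EuclideanSpace ℝ (Fin d))}

/-- The function `v ↦ exp (-Φ(2πv))`. -/
noncomputable def levySymbol (ν : Measure (EuclideanSpace ℝ (Fin d)))
    (v : EuclideanSpace ℝ (Fin d)) : ℝ :=
  Real.exp (-levyExponent ν ((2 * Real.pi) • v))

theorem levySymbol_nonneg (ν : Measure (EuclideanSpace ℝ (Fin d)))
    (v : EuclideanSpace ℝ (Fin d)) : 0 ≤ levySymbol ν v := Real.exp_nonneg _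

theorem levySymbol_le_one (ν : Measure (EuclideanSpace ℝ (Fin d)))
    (v : EuclideanSpace ℝ (Fin d)) : levySymbol ν v ≤ 1 :=
  Real.exp_le_one_iff.2 (neg_nonpos.2 (levyExponent_nonneg _ _))

theorem levySymbol_neg (ν : Measure (EuclideanSpace ℝ (Fin d)))
    (v : EuclideanSpace ℝ (Fin d)) : levySymbol ν (-v) = levySymbol ν v := by
  rw [levySymbol, smul_neg, levyExponent_neg, levySymbol]

theorem IsSymmetricLevyMeasure.continuous_levySymbol (hν : IsSymmetricLevyMeasure ν) :
    Continuous (levySymbol ν) := by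
  have := hν.continuous_levyExponent
  unfold levySymbol
  fun_prop

theorem IsSymmetricLevyMeasure.integrable_levySymbol_mul (hν : IsSymmetricLevyMeasure ν)
    {g : EuclideanSpace ℝ (Fin d) → ℝ} (hg : Integrable g) :
    Integrable (fun v => levySymbol ν v * g v) := by
  refine hg.mono (hν.continuous_levySymbol.aestronglyMeasurable.mul hg.1) (ae_of_all _ fun v => ?_)
  rw [norm_mul, Real.norm_of_nonneg (levySymbol_nonneg ν v)]
  exact mul_le_of_le_one_left (norm_nonneg _) (levySymbol_le_one ν v)

theorem IsSymmetricLevyMeasure.charFun_convExp_two_pi_smul [IsFiniteMeasure ν]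
    (hν : IsSymmetricLevyMeasure ν) (v : EuclideanSpace ℝ (Fin d)) :
    charFun (convExp ν) ((2 * Real.pi) • v)
      = ((Real.exp (ν.real Set.univ) * levySymbol ν v : ℝ) : ℂ) := by
  rw [hν.charFun_convExp_eq, levySymbol, ← Real.exp_add, sub_eq_add_neg]

theorem cosTransform_const_mul (a : ℝ) (h : EuclideanSpace ℝ (Fin d) → ℝ)
    (x : EuclideanSpace ℝ (Fin d)) :
    cosTransform (fun v => a * h v) x = a * cosTransform h x := by
  unfold cosTransform
  rw [← integral_const_mul]
  refine integral_congr_ae (ae_of_all _ fun v => ?_)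
  dsimp only
  ring

/-- For finite `ν` the symbol belongs to the compound Poisson law, that is, `convExp ν` normalised
by `exp (-ν(ℝ^d))`. -/
theorem IsSymmetricLevyMeasure.cosTransform_levySymbol_mul [IsFiniteMeasure ν]
    (hν : IsSymmetricLevyMeasure ν) {h : EuclideanSpace ℝ (Fin d) → ℝ} (hh : Integrable h)
    (x : EuclideanSpace ℝ (Fin d)) :
    cosTransform (fun v => levySymbol ν v * h v) x
      = Real.exp (-ν.real Set.univ) * ∫ y, cosTransform h (x - y) ∂(convExp ν) := by
  rw [integral_cosTransform_sub hν.charFun_convExp_two_pi_smul hh]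
  simp_rw [mul_assoc]
  rw [cosTransform_const_mul, ← mul_assoc, ← Real.exp_add, neg_add_cancel, Real.exp_zero, one_mul]

theorem IsSymmetricLevyMeasure.cosTransform_levySymbol_mul_nonneg_of_finite [IsFiniteMeasure ν]
    (hν : IsSymmetricLevyMeasure ν) {h : EuclideanSpace ℝ (Fin d) → ℝ} (hh : Integrable h)
    (hpos : ∀ x, 0 ≤ cosTransform h x) (x : EuclideanSpace ℝ (Fin d)) :
    0 ≤ cosTransform (fun v => levySymbol ν v * h v) x := by
  rw [hν.cosTransform_levySymbol_mul hh]
  exact mul_nonneg (Real.exp_nonneg _) (integral_nonneg fun y => hpos _)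

theorem tendsto_cosTransform {F : ℕ → EuclideanSpace ℝ (Fin d) → ℝ}
    {f bound : EuclideanSpace ℝ (Fin d) → ℝ} (hF : ∀ n, Integrable (F n))
    (hb : Integrable bound) (hle : ∀ n v, |F n v| ≤ bound v)
    (hlim : ∀ v, Filter.Tendsto (fun n => F n v) Filter.atTop (nhds (f v)))
    (x : EuclideanSpace ℝ (Fin d)) :
    Filter.Tendsto (fun n => cosTransform (F n) x) Filter.atTop (nhds (cosTransform f x)) := by
  refine tendsto_integral_of_dominated_convergence bound
    (fun n => (integrable_cos_mul (hF n) x).1) hb (fun n => ae_of_all _ fun v => ?_)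
    (ae_of_all _ fun v => (hlim v).const_mul _)
  rw [norm_mul]
  exact (mul_le_of_le_one_left (norm_nonneg _) (Real.abs_cos_le_one _)).trans (hle n v)

theorem IsSymmetricLevyMeasure.tendsto_levyExponent (hν : IsSymmetricLevyMeasure ν)
    (ξ : EuclideanSpace ℝ (Fin d)) :
    Filter.Tendsto (fun n : ℕ =>
      levyExponent (ν.restrict (Metric.ball 0 (1 / ((n : ℝ) + 1)))ᶜ) ξ)
      Filter.atTop (nhds (levyExponent ν ξ)) := by
  have h := tendsto_integral_of_dominated_convergence (μ := ν)
    (F := fun (n : ℕ) => Set.indicator (Metric.ball 0 (1 / ((n : ℝ) + 1)))ᶜ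
      fun y => 1 - Real.cos (inner ℝ ξ y))
    (f := fun y => 1 - Real.cos (inner ℝ ξ y)) (fun y => 1 - Real.cos (inner ℝ ξ y))
    (fun n => (hν.integrable_one_sub_cos ξ).1.indicator measurableSet_ball.compl)
    (hν.integrable_one_sub_cos ξ) (fun n => ae_of_all _ fun y => ?_) (ae_of_all _ fun y => ?_)
  · simp_rw [integral_indicator (measurableSet_ball (α := EuclideanSpace ℝ (Fin d))).compl] at h
    exact h
  · refine (norm_indicator_le_norm_self _ _).trans ?_
    rw [Real.norm_of_nonneg (one_sub_cos_inner_nonneg ξ y)]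
  -- The origin is never in the complement of the ball, but the integrand vanishes there.
  · by_cases hy : y = 0
    · subst hy
      have h0 : ∀ s : Set (EuclideanSpace ℝ (Fin d)),
          s.indicator (fun y => 1 - Real.cos (inner ℝ ξ y)) 0 = 0 := fun s =>
        Set.indicator_apply_eq_zero.2 (by simp)
      simp only [h0, inner_zero_right, Real.cos_zero, sub_self, tendsto_const_nhds]
    · refine tendsto_const_nhds.congr' ?_
      filter_upwards [(tendsto_one_div_add_atTop_nhds_zero_nat (𝕜 := ℝ)).eventually_lt_const
        (norm_pos_iff.2 hy)] with n hn
      rw [Set.indicator_of_mem]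
      simpa using hn.le

/-- Removing jumps smaller than `1 / (n + 1)` leaves a finite Lévy measure, where the transform is
an average of nonnegative values; positivity passes to the limit by dominated convergence. -/
theorem IsSymmetricLevyMeasure.cosTransform_levySymbol_mul_nonneg
    (hν : IsSymmetricLevyMeasure ν) {h : EuclideanSpace ℝ (Fin d) → ℝ} (hh : Integrable h)
    (hpos : ∀ x, 0 ≤ cosTransform h x) (x : EuclideanSpace ℝ (Fin d)) :
    0 ≤ cosTransform (fun v => levySymbol ν v * h v) x := by
  refine ge_of_tendsto (tendsto_cosTransform (F := fun n v =>
      levySymbol (ν.restrict (Metric.ball 0 (1 / ((n : ℝ) + 1)))ᶜ) v * h v)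
    (bound := fun v => |h v|)
    (fun n => (hν.restrict_compl_ball _).integrable_levySymbol_mul hh) hh.abs
    (fun n v => ?_) (fun v => ?_) x) (Filter.Eventually.of_forall fun n => ?_)
  · rw [abs_mul, abs_of_nonneg (levySymbol_nonneg _ v)]
    exact mul_le_of_le_one_left (abs_nonneg _) (levySymbol_le_one _ v)
  · exact ((Real.continuous_exp.tendsto _).comp (hν.tendsto_levyExponent _).neg).mul_const _
  · have hfin := hν.isFiniteMeasure_restrict_compl_ball (r := 1 / ((n : ℝ) + 1)) (by positivity)
    exact (hν.restrict_compl_ball _).cosTransform_levySymbol_mul_nonneg_of_finite hh hpos x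

/-- The density `x ↦ ∫ cos (2π ⟨v, x⟩) exp (-Φ(2πv)) dv` of the infinitely divisible law with
Lévy measure `ν`. -/
noncomputable def levyKernel (ν : Measure (EuclideanSpace ℝ (Fin d))) :
    EuclideanSpace ℝ (Fin d) → ℝ :=
  cosTransform (levySymbol ν)

/-- The constant `1` is not integrable, so Gaussians increasing to it serve as the auxiliary factor
with nonnegative transform. -/
theorem IsSymmetricLevyMeasure.levyKernel_nonneg (hν : IsSymmetricLevyMeasure ν)
    (hint : Integrable (levySymbol ν)) (x : EuclideanSpace ℝ (Fin d)) : 0 ≤ levyKernel ν x := by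
  have hpos : ∀ n : ℕ, 0 < 1 / ((n : ℝ) + 1) := fun n => by positivity
  refine ge_of_tendsto (tendsto_cosTransform (F := fun n v =>
      levySymbol ν v * Real.exp (-(1 / ((n : ℝ) + 1)) * ‖v‖ ^ 2))
    (bound := levySymbol ν)
    (fun n => hν.integrable_levySymbol_mul (integrable_exp_neg_mul_sq_norm (hpos n))) hint
    (fun n v => ?_) (fun v => ?_) x) (Filter.Eventually.of_forall fun n =>
      hν.cosTransform_levySymbol_mul_nonneg (integrable_exp_neg_mul_sq_norm (hpos n))
        (cosTransform_exp_neg_mul_sq_norm_nonneg (hpos n)) x)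
  · rw [abs_of_nonneg (mul_nonneg (levySymbol_nonneg _ _) (Real.exp_nonneg _))]
    refine mul_le_of_le_one_right (levySymbol_nonneg _ _) (Real.exp_le_one_iff.2 ?_)
    have := (hpos n).le
    rw [neg_mul]
    exact neg_nonpos.2 (by positivity)
  · have h0 := ((tendsto_one_div_add_atTop_nhds_zero_nat (𝕜 := ℝ)).neg.mul_const (‖v‖ ^ 2))
    rw [neg_zero, zero_mul] at h0
    simpa using ((Real.continuous_exp.tendsto 0).comp h0).const_mul (levySymbol ν v)

theorem IsSymmetricLevyMeasure.integrable_levyKernel (hν : IsSymmetricLevyMeasure ν)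
    (hint : Integrable (levySymbol ν)) : Integrable (levyKernel ν) :=
  integrable_cosTransform hint (levySymbol_le_one ν) (hν.levyKernel_nonneg hint)

/-- The infinitely divisible law with Lévy measure `ν`. -/
noncomputable def levyLaw (ν : Measure (EuclideanSpace ℝ (Fin d))) :
    Measure (EuclideanSpace ℝ (Fin d)) :=
  volume.withDensity fun x => ENNReal.ofReal (levyKernel ν x)

theorem IsSymmetricLevyMeasure.charFun_levyLaw (hν : IsSymmetricLevyMeasure ν)
    (hint : Integrable (levySymbol ν)) (ξ : EuclideanSpace ℝ (Fin d)) :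
    charFun (levyLaw ν) ξ = ((Real.exp (-levyExponent ν ξ) : ℝ) : ℂ) := by
  have h := charFun_withDensity_cosTransform hν.continuous_levySymbol hint (levySymbol_neg ν)
    (hν.levyKernel_nonneg hint) (hν.integrable_levyKernel hint) ((2 * Real.pi)⁻¹ • ξ)
  rw [levySymbol, smul_smul, mul_inv_cancel₀ (by positivity), one_smul] at h
  exact h

theorem IsSymmetricLevyMeasure.isProbabilityMeasure_levyLaw (hν : IsSymmetricLevyMeasure ν)
    (hint : Integrable (levySymbol ν)) : IsProbabilityMeasure (levyLaw ν) := by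
  have h := hν.charFun_levyLaw hint 0
  rw [charFun_zero, levyExponent_zero, neg_zero, Real.exp_zero] at h
  have h1 : (levyLaw ν).real Set.univ = 1 := by exact_mod_cast h
  exact ⟨(ENNReal.toReal_eq_one_iff _).1 h1⟩

theorem levySymbol_restrict_mul (hν : IsSymmetricLevyMeasure ν)
    {s : Set (EuclideanSpace ℝ (Fin d))} (hs : MeasurableSet s) (v : EuclideanSpace ℝ (Fin d)) :
    levySymbol (ν.restrict sᶜ) v * levySymbol (ν.restrict s) v = levySymbol ν v := by
  rw [levySymbol, levySymbol, levySymbol, ← Real.exp_add, ← hν.levyExponent_add_compl hs]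
  congr 1
  ring

/-- Lower bound of the density by the contribution of paths with exactly one large jump. -/
theorem IsSymmetricLevyMeasure.le_levyKernel_of_one_jump (hν : IsSymmetricLevyMeasure ν)
    {r ρ b : ℝ} (hr : 0 < r) (hint : Integrable (levySymbol (ν.restrict (Metric.ball 0 r))))
    (hb : 0 ≤ b) (hlow : ∀ z, ‖z‖ < ρ → b ≤ levyKernel (ν.restrict (Metric.ball 0 r)) z)
    {x : EuclideanSpace ℝ (Fin d)} (hx : Metric.ball x ρ ⊆ (Metric.ball 0 r)ᶜ) :
    Real.exp (-ν.real (Metric.ball 0 r)ᶜ) * (b * ν.real (Metric.ball x ρ)) ≤ levyKernel ν x := by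
  have hfin := hν.isFiniteMeasure_restrict_compl_ball hr
  have hνs := hν.restrict_ball r
  have hνb := hν.restrict_compl_ball r
  have h1 : levyKernel ν x = cosTransform (fun v => levySymbol (ν.restrict (Metric.ball 0 r)ᶜ) v *
      levySymbol (ν.restrict (Metric.ball 0 r)) v) x := by
    simp_rw [levySymbol_restrict_mul hν measurableSet_ball]
    rfl
  rw [h1, hνb.cosTransform_levySymbol_mul hint, measureReal_restrict_apply_univ]
  refine mul_le_mul_of_nonneg_left ?_ (Real.exp_nonneg _)
  set M := convExp (ν.restrict (Metric.ball 0 r)ᶜ) with hM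
  have hcont : Continuous fun y => cosTransform (levySymbol (ν.restrict (Metric.ball 0 r))) (x - y)
    := (continuous_cosTransform hint).comp (by fun_prop)
  have hintM : Integrable (fun y =>
      cosTransform (levySymbol (ν.restrict (Metric.ball 0 r))) (x - y)) M :=
    Integrable.of_bound hcont.aestronglyMeasurable _ (ae_of_all _ fun y =>
      abs_cosTransform_le _ hint (x - y))
  -- The ball about `x` lies among the large jumps, so the restriction loses none of its mass.
  have hmeas : ν.real (Metric.ball x ρ) ≤ M.real (Metric.ball x ρ) := by
    have h2 : (ν.restrict (Metric.ball 0 r)ᶜ).real (Metric.ball x ρ) = ν.real (Metric.ball x ρ) := by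
      rw [measureReal_restrict_apply measurableSet_ball, Set.inter_eq_left.2 hx]
    rw [← h2]
    exact ENNReal.toReal_mono (measure_ne_top _ _) (le_convExp _ _)
  calc b * ν.real (Metric.ball x ρ) ≤ b * M.real (Metric.ball x ρ) := by gcongr
    _ ≤ ∫ y in Metric.ball x ρ,
        cosTransform (levySymbol (ν.restrict (Metric.ball 0 r))) (x - y) ∂M := by
        rw [mul_comm, ← smul_eq_mul, ← setIntegral_const]
        refine setIntegral_mono_on (integrableOn_const (measure_ne_top _ _)) hintM.integrableOn
          measurableSet_ball fun y hy => hlow _ ?_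
        rwa [← dist_eq_norm, dist_comm]
    _ ≤ _ := setIntegral_le_integral hintM (ae_of_all _ fun y => hνs.levyKernel_nonneg hint _)

end LevyKernel

/-! ### Lower bound near the origin at scale `T`. -/

section NearOrigin

variable {d : ℕ} {ν : Measure (EuclideanSpace ℝ (Fin d))}

/-- Polar coordinates reduce this to a Gamma-type integral on the half-line; positive dimension
makes the space nontrivial. -/
theorem integrable_norm_pow_mul_exp_neg_mul_norm_rpow (hd : 0 < d) {κ α : ℝ} (hκ : 0 < κ)
    (hα : 0 < α) (n : ℕ) :
    Integrable (fun v : EuclideanSpace ℝ (Fin d) => ‖v‖ ^ n * Real.exp (-κ * ‖v‖ ^ α)) := by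
  have : Nonempty (Fin d) := ⟨⟨0, hd⟩⟩
  refine (integrable_fun_norm_addHaar (volume : Measure (EuclideanSpace ℝ (Fin d)))
    (f := fun y : ℝ => y ^ n * Real.exp (-κ * y ^ α))).2 ?_
  refine (integrableOn_rpow_mul_exp_neg_mul_rpow (p := α)
    (s := ((Module.finrank ℝ (EuclideanSpace ℝ (Fin d)) - 1 + n : ℕ) : ℝ))
    (neg_one_lt_zero.trans_le (Nat.cast_nonneg _)) hα hκ).congr_fun
    (fun y hy => ?_) measurableSet_Ioi
  dsimp only
  rw [Real.rpow_natCast, pow_add, smul_eq_mul, mul_assoc]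

theorem one_sub_cos_le_abs (u : ℝ) : 1 - Real.cos u ≤ |u| := by
  rcases le_total |u| 2 with h | h
  · have := Real.one_sub_sq_div_two_le_cos (x := u)
    rw [← sq_abs] at this
    nlinarith [abs_nonneg u]
  · linarith [Real.neg_one_le_cos u]

/-- Here `T` is the spatial scale and `L` the loss caused by discarding large jumps (zero if none
are discarded). -/
theorem levySymbol_le_of_le_levyExponent {κ α T L : ℝ} (hT : 0 < T)
    (hlow : ∀ ξ, κ * ((T * ‖ξ‖) ^ α - 1) - L ≤ levyExponent ν ξ)
    (v : EuclideanSpace ℝ (Fin d)) :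
    levySymbol ν v ≤ Real.exp (L + κ) * Real.exp (-κ * ‖(2 * Real.pi * T) • v‖ ^ α) := by
  have h := hlow ((2 * Real.pi) • v)
  have hn : ‖(2 * Real.pi * T) • v‖ = T * ‖(2 * Real.pi) • v‖ := by
    have := Real.pi_pos
    rw [norm_smul, norm_smul, Real.norm_of_nonneg (by positivity),
      Real.norm_of_nonneg (by positivity)]
    ring
  rw [levySymbol, ← Real.exp_add, hn]
  gcongr
  linarith

theorem IsSymmetricLevyMeasure.integrable_norm_pow_mul_levySymbol
    (hν : IsSymmetricLevyMeasure ν) (hd : 0 < d)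
    {κ α T L : ℝ} (hκ : 0 < κ) (hα : 0 < α) (hT : 0 < T)
    (hlow : ∀ ξ, κ * ((T * ‖ξ‖) ^ α - 1) - L ≤ levyExponent ν ξ) (n : ℕ) :
    Integrable (fun v => ‖v‖ ^ n * levySymbol ν v) := by
  have hpi := Real.pi_pos
  set R := 2 * Real.pi * T with hR
  have hRpos : 0 < R := by positivity
  have h := ((integrable_norm_pow_mul_exp_neg_mul_norm_rpow hd hκ hα n).comp_smul
    hRpos.ne').const_mul ((R ^ n)⁻¹ * Real.exp (L + κ))
  have hc := hν.continuous_levySymbol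
  refine h.mono' (by fun_prop) (ae_of_all _ fun v => ?_)
  rw [Real.norm_of_nonneg (mul_nonneg (by positivity) (levySymbol_nonneg _ _))]
  calc ‖v‖ ^ n * levySymbol ν v
      ≤ ‖v‖ ^ n * (Real.exp (L + κ) * Real.exp (-κ * ‖R • v‖ ^ α)) := by
        gcongr
        exact levySymbol_le_of_le_levyExponent hT hlow v
    _ = _ := by
        have hn : ‖R • v‖ ^ n = R ^ n * ‖v‖ ^ n := by
          rw [norm_smul, Real.norm_of_nonneg hRpos.le, mul_pow]
        rw [hn]
        field_simp

/-- From `cos u ≥ 1 - |u|`, the density at `z` is at least the integral of the symbol minus `2π‖z‖`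
times its first moment. After the substitution `w = 2πT v`, the first integral is bounded below on
the unit ball by the upper bound on the exponent, the second above by the lower bound. -/
theorem IsSymmetricLevyMeasure.le_levyKernel_near_zero
    (hν : IsSymmetricLevyMeasure ν) (hd : 0 < d)
    {κ α T L c : ℝ} (hκ : 0 < κ) (hα : 0 < α) (hT : 0 < T)
    (hlow : ∀ ξ, κ * ((T * ‖ξ‖) ^ α - 1) - L ≤ levyExponent ν ξ)
    (hup : ∀ ξ, T * ‖ξ‖ ≤ 1 → levyExponent ν ξ ≤ c) (z : EuclideanSpace ℝ (Fin d)) :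
    ((2 * Real.pi * T) ^ d)⁻¹ *
      (Real.exp (-c) * (volume : Measure (EuclideanSpace ℝ (Fin d))).real (Metric.ball 0 1)
        - ‖z‖ / T * Real.exp (L + κ) *
          ∫ w : EuclideanSpace ℝ (Fin d), ‖w‖ * Real.exp (-κ * ‖w‖ ^ α)) ≤ levyKernel ν z := by
  have hpi := Real.pi_pos
  have hint := hν.integrable_norm_pow_mul_levySymbol hd hκ hα hT hlow
  have hi0 : Integrable (levySymbol ν) := by simpa using hint 0
  set R := 2 * Real.pi * T with hR
  have hRpos : 0 < R := by positivity
  have hscale : ∀ f : EuclideanSpace ℝ (Fin d) → ℝ,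
      ∫ v, f (R • v) = (R ^ d)⁻¹ * ∫ w, f w := fun f => by
    rw [Measure.integral_comp_smul, finrank_euclideanSpace, Fintype.card_fin,
      abs_of_pos (by positivity), smul_eq_mul]
  have hA : (R ^ d)⁻¹ * (Real.exp (-c) *
      (volume : Measure (EuclideanSpace ℝ (Fin d))).real (Metric.ball 0 1))
      ≤ ∫ v, levySymbol ν v := by
    have hball : Integrable ((Metric.ball (0 : EuclideanSpace ℝ (Fin d)) 1).indicator
        fun _ => Real.exp (-c)) :=
      (integrable_indicator_iff measurableSet_ball).2
        (integrableOn_const measure_ball_lt_top.ne)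
    have h1 := hscale ((Metric.ball (0 : EuclideanSpace ℝ (Fin d)) 1).indicator
      fun _ => Real.exp (-c))
    rw [integral_indicator measurableSet_ball, setIntegral_const, smul_eq_mul] at h1
    rw [mul_comm (Real.exp (-c)), ← h1]
    refine integral_mono (hball.comp_smul hRpos.ne') hi0 fun v => ?_
    refine Set.indicator_apply_le' (fun hv => ?_) fun _ => levySymbol_nonneg ν v
    refine Real.exp_le_exp.2 (neg_le_neg (hup _ ?_))
    rw [mem_ball_zero_iff, norm_smul, Real.norm_of_nonneg hRpos.le] at hv
    rw [norm_smul, Real.norm_of_nonneg (by positivity)]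
    refine le_trans (le_of_eq ?_) hv.le
    ring
  have hB : ∫ v, 2 * Real.pi * ‖v‖ * ‖z‖ * levySymbol ν v ≤ (R ^ d)⁻¹ * (‖z‖ / T *
      Real.exp (L + κ) * ∫ w : EuclideanSpace ℝ (Fin d), ‖w‖ * Real.exp (-κ * ‖w‖ ^ α)) := by
    have h1 := hscale (fun w => ‖z‖ / T * Real.exp (L + κ) * (‖w‖ * Real.exp (-κ * ‖w‖ ^ α)))
    rw [integral_const_mul (μ := volume) (f := fun w : EuclideanSpace ℝ (Fin d) =>
      ‖w‖ * Real.exp (-κ * ‖w‖ ^ α))] at h1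
    rw [← h1]
    have hJ : Integrable fun w : EuclideanSpace ℝ (Fin d) =>
        ‖z‖ / T * Real.exp (L + κ) * (‖w‖ * Real.exp (-κ * ‖w‖ ^ α)) := by
      simpa using (integrable_norm_pow_mul_exp_neg_mul_norm_rpow hd hκ hα 1).const_mul
        (‖z‖ / T * Real.exp (L + κ))
    refine integral_mono ?_ (hJ.comp_smul hRpos.ne') fun v => ?_
    · refine ((hint 1).const_mul (2 * Real.pi * ‖z‖)).congr (ae_of_all _ fun v => ?_)
      dsimp only
      ring
    · dsimp only
      calc 2 * Real.pi * ‖v‖ * ‖z‖ * levySymbol ν v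
          ≤ 2 * Real.pi * ‖v‖ * ‖z‖ * (Real.exp (L + κ) * Real.exp (-κ * ‖R • v‖ ^ α)) := by
            gcongr
            exact levySymbol_le_of_le_levyExponent hT hlow v
        _ = _ := by
            have hn : 2 * Real.pi * ‖v‖ = ‖R • v‖ / T := by
              rw [norm_smul, Real.norm_of_nonneg hRpos.le, hR]
              field_simp
            rw [hn]
            ring
  have hC : ∫ v, (levySymbol ν v - 2 * Real.pi * ‖v‖ * ‖z‖ * levySymbol ν v)
      ≤ levyKernel ν z := by
    refine integral_mono (hi0.sub ?_) (integrable_cos_mul hi0 z) fun v => ?_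
    · refine ((hint 1).const_mul (2 * Real.pi * ‖z‖)).congr (ae_of_all _ fun v => ?_)
      dsimp only
      ring
    · have h1 := one_sub_cos_le_abs (2 * Real.pi * inner ℝ v z)
      have h2 : |2 * Real.pi * inner ℝ v z| ≤ 2 * Real.pi * ‖v‖ * ‖z‖ := by
        rw [abs_mul, abs_of_pos (by positivity), mul_assoc (2 * Real.pi)]
        gcongr
        exact abs_real_inner_le_norm v z
      have h3 := levySymbol_nonneg ν v
      dsimp only
      nlinarith
  rw [integral_sub hi0] at hC
  · rw [mul_sub]
    linarith
  · refine ((hint 1).const_mul (2 * Real.pi * ‖z‖)).congr (ae_of_all _ fun v => ?_)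
    dsimp only
    ring

end NearOrigin

/-! ### Existence, uniqueness and smooth densities of the semigroup. -/

section Semigroup

open scoped FourierTransform

variable {d : ℕ} {ν : Measure (EuclideanSpace ℝ (Fin d))}

theorem contDiff_levyKernel
    (hint : ∀ n : ℕ, Integrable (fun v => ‖v‖ ^ n * levySymbol ν v)) :
    ContDiff ℝ (⊤ : ℕ∞) (levyKernel ν) := by
  have hi0 : Integrable (levySymbol ν) := by simpa using hint 0
  have hF : levyKernel ν = fun x => (𝓕 (fun v => (levySymbol ν v : ℂ)) x).re :=
    funext fun x => by
      rw [fourier_ofReal_eq_cosTransform hi0 (levySymbol_neg ν), Complex.ofReal_re, levyKernel]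
  rw [hF]
  refine Complex.reCLM.contDiff.comp (Real.contDiff_fourier fun n _ => ?_)
  refine (hint n).congr (ae_of_all _ fun v => ?_)
  dsimp only
  rw [Complex.norm_real, Real.norm_of_nonneg (levySymbol_nonneg _ _)]

theorem IsSymmetricLevyMeasure.charFun_levyLaw_smul (hν : IsSymmetricLevyMeasure ν) {t : ℝ≥0}
    (hint : Integrable (levySymbol (t • ν))) (ξ : EuclideanSpace ℝ (Fin d)) :
    charFun (levyLaw (t • ν)) ξ = ((Real.exp (-(t * levyExponent ν ξ)) : ℝ) : ℂ) := by
  rw [(hν.smul t).charFun_levyLaw hint, levyExponent_smul]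

theorem IsSymmetricLevyMeasure.exists_isLevySemigroup (hν : IsSymmetricLevyMeasure ν)
    (hint : ∀ t : ℝ≥0, 0 < t → Integrable (levySymbol (t • ν))) :
    ∃ P, IsLevySemigroup ν P := by
  classical
  -- At `t = 0` the symbol is identically one and yields no density, so the unit mass at the origin
  -- is inserted by hand.
  let P : ℝ≥0 → Measure (EuclideanSpace ℝ (Fin d)) := fun t =>
    if t = 0 then Measure.dirac 0 else levyLaw (t • ν)
  have hprob : ∀ t, IsProbabilityMeasure (P t) := fun t => by
    by_cases ht : t = 0
    · simp only [P, if_pos ht]; infer_instance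
    · simp only [P, if_neg ht]
      exact (hν.smul t).isProbabilityMeasure_levyLaw (hint t (pos_iff_ne_zero.2 ht))
  have hchar : ∀ t ξ, charFun (P t) ξ = ((Real.exp (-(t * levyExponent ν ξ)) : ℝ) : ℂ) := by
    intro t ξ
    by_cases ht : t = 0
    · simp [P, ht, charFun_dirac]
    · simp only [P, if_neg ht]
      exact hν.charFun_levyLaw_smul (hint t (pos_iff_ne_zero.2 ht)) ξ
  refine ⟨P, hprob, fun s t => ?_, hchar⟩
  refine Measure.ext_of_charFun (funext fun ξ => ?_)
  rw [charFun_conv, hchar, hchar, hchar, ← Complex.ofReal_mul, ← Real.exp_add, NNReal.coe_add]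
  congr 2
  ring

theorem IsLevySemigroup.eq_levyLaw {P : ℝ≥0 → Measure (EuclideanSpace ℝ (Fin d))}
    (hP : IsLevySemigroup ν P) (hν : IsSymmetricLevyMeasure ν) {t : ℝ≥0}
    (hint : Integrable (levySymbol (t • ν))) : P t = levyLaw (t • ν) := by
  have := hP.isProbabilityMeasure t
  have := (hν.smul t).isProbabilityMeasure_levyLaw hint
  refine Measure.ext_of_charFun (funext fun ξ => ?_)
  rw [hP.charFun_eq, hν.charFun_levyLaw_smul hint]

theorem IsLevySemigroup.isSmoothBoundedDensity_levyKernel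
    {P : ℝ≥0 → Measure (EuclideanSpace ℝ (Fin d))}
    (hP : IsLevySemigroup ν P) (hν : IsSymmetricLevyMeasure ν)
    (hint : ∀ t : ℝ≥0, 0 < t → ∀ n : ℕ, Integrable (fun v => ‖v‖ ^ n * levySymbol (t • ν) v)) :
    IsSmoothBoundedDensity P fun t => levyKernel (t • ν) := by
  intro t ht
  have hi0 : Integrable (levySymbol (t • ν)) := by simpa using hint t ht 0
  exact ⟨contDiff_levyKernel (hint t ht), (hν.smul t).levyKernel_nonneg hi0,
    ⟨_, fun x => (le_abs_self _).trans (abs_cosTransform_le _ hi0 x)⟩, hP.eq_levyLaw hν hi0⟩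

/-- Case `T = 1`, `L = 0` of the growth condition: for `‖ξ‖ ≤ 1` the left side is nonpositive. It
serves every `t`, not only large times. -/
theorem le_levyExponent_smul_of_le {α c₀ : ℝ} (hα : 0 < α) (hc₀ : 0 < c₀)
    (h : ∀ ξ : EuclideanSpace ℝ (Fin d), 1 < ‖ξ‖ → c₀ * ‖ξ‖ ^ α ≤ levyExponent ν ξ)
    (t : ℝ≥0) (ξ : EuclideanSpace ℝ (Fin d)) :
    t * c₀ * ((1 * ‖ξ‖) ^ α - 1) - 0 ≤ levyExponent (t • ν) ξ := by
  rw [levyExponent_smul, one_mul, sub_zero, mul_assoc]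
  refine mul_le_mul_of_nonneg_left ?_ t.2
  rcases le_or_gt ‖ξ‖ 1 with h1 | h1
  · have := Real.rpow_le_one (norm_nonneg ξ) h1 hα.le
    nlinarith [levyExponent_nonneg ν ξ]
  · nlinarith [h ξ h1]

/-! ### Bounds on the exponent at scale `T = t ^ (1/β)`. -/

section LargeTime

variable {α β c₀ c : ℝ}

/-- For `‖ξ‖ ≤ 1` the exponent `β` scales exactly, and `u ^ α - 1 ≤ u ^ β` for all `u ≥ 0`. For `‖ξ‖
> 1` one uses `T ^ α ≤ T ^ β`. A single `α`-growth bound thus covers both regimes. -/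
theorem le_levyExponent_smul_scaled (hα : 0 < α) (hβ : α ≤ β) (hc₀ : 0 < c₀) (hc : 0 < c)
    (h : ∀ ξ : EuclideanSpace ℝ (Fin d), 1 < ‖ξ‖ → c₀ * ‖ξ‖ ^ α ≤ levyExponent ν ξ)
    (h' : ∀ ξ : EuclideanSpace ℝ (Fin d), ‖ξ‖ ≤ 1 → c⁻¹ * ‖ξ‖ ^ β ≤ levyExponent ν ξ)
    {t : ℝ≥0} {T : ℝ} (hT : 1 ≤ T) (htT : T ^ β = t) (ξ : EuclideanSpace ℝ (Fin d)) :
    min c⁻¹ c₀ * ((T * ‖ξ‖) ^ α - 1) ≤ levyExponent (t • ν) ξ := by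
  have hT0 : 0 < T := one_pos.trans_le hT
  have hκ : 0 < min c⁻¹ c₀ := lt_min (inv_pos.2 hc) hc₀
  have hξ := norm_nonneg ξ
  rw [levyExponent_smul, ← htT]
  rcases le_or_gt ‖ξ‖ 1 with h1 | h1
  · have hpow : (T * ‖ξ‖) ^ α - 1 ≤ (T * ‖ξ‖) ^ β := by
      rcases le_total (T * ‖ξ‖) 1 with h2 | h2
      · have h3 := Real.rpow_le_one (by positivity) h2 hα.le
        have h4 : 0 ≤ (T * ‖ξ‖) ^ β := by positivity
        linarith
      · have := Real.rpow_le_rpow_of_exponent_le h2 hβ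
        linarith
    calc min c⁻¹ c₀ * ((T * ‖ξ‖) ^ α - 1) ≤ min c⁻¹ c₀ * (T * ‖ξ‖) ^ β := by gcongr
      _ ≤ c⁻¹ * (T * ‖ξ‖) ^ β := by gcongr; exact min_le_left _ _
      _ = T ^ β * (c⁻¹ * ‖ξ‖ ^ β) := by rw [Real.mul_rpow hT0.le hξ]; ring
      _ ≤ _ := by gcongr; exact h' ξ h1
  · calc min c⁻¹ c₀ * ((T * ‖ξ‖) ^ α - 1) ≤ min c⁻¹ c₀ * (T * ‖ξ‖) ^ α := by gcongr; linarith
      _ ≤ c₀ * (T * ‖ξ‖) ^ α := by gcongr; exact min_le_right _ _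
      _ = T ^ α * (c₀ * ‖ξ‖ ^ α) := by rw [Real.mul_rpow hT0.le hξ]; ring
      _ ≤ T ^ β * (c₀ * ‖ξ‖ ^ α) := by gcongr
      _ ≤ _ := by gcongr; exact h ξ h1

theorem levyExponent_smul_scaled_le (hβ : 0 < β) (hc : 0 < c)
    (h : ∀ ξ : EuclideanSpace ℝ (Fin d), ‖ξ‖ ≤ 1 → levyExponent ν ξ ≤ c * ‖ξ‖ ^ β)
    {t : ℝ≥0} {T : ℝ} (hT : 1 ≤ T) (htT : T ^ β = t) (ξ : EuclideanSpace ℝ (Fin d))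
    (hξ : T * ‖ξ‖ ≤ 1) : levyExponent (t • ν) ξ ≤ c := by
  have hn := norm_nonneg ξ
  have hT0 : 0 < T := one_pos.trans_le hT
  have h1 : ‖ξ‖ ≤ 1 := by nlinarith
  rw [levyExponent_smul, ← htT]
  calc T ^ β * levyExponent ν ξ ≤ T ^ β * (c * ‖ξ‖ ^ β) := by gcongr; exact h ξ h1
    _ = c * (T * ‖ξ‖) ^ β := by rw [Real.mul_rpow hT0.le hn]; ring
    _ ≤ c := mul_le_of_le_one_right hc.le (Real.rpow_le_one (by positivity) hξ hβ.le)

theorem IsSymmetricLevyMeasure.levyExponent_sub_le_restrict_ball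
    (hν : IsSymmetricLevyMeasure ν) {r : ℝ} (hr : 0 < r) (ξ : EuclideanSpace ℝ (Fin d)) :
    levyExponent ν ξ - 2 * ν.real (Metric.ball 0 r)ᶜ
      ≤ levyExponent (ν.restrict (Metric.ball 0 r)) ξ := by
  have := hν.isFiniteMeasure_restrict_compl_ball hr
  have h := levyExponent_le_two_mul (ν := ν.restrict (Metric.ball 0 r)ᶜ) ξ
  rw [measureReal_restrict_apply_univ] at h
  linarith [hν.levyExponent_add_compl measurableSet_ball (s := Metric.ball 0 r) ξ]

theorem IsSymmetricLevyMeasure.levyExponent_restrict_ball_le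
    (hν : IsSymmetricLevyMeasure ν) (r : ℝ) (ξ : EuclideanSpace ℝ (Fin d)) :
    levyExponent (ν.restrict (Metric.ball 0 r)) ξ ≤ levyExponent ν ξ := by
  linarith [hν.levyExponent_add_compl measurableSet_ball (s := Metric.ball 0 r) ξ,
    levyExponent_nonneg (ν.restrict (Metric.ball 0 r)ᶜ) ξ]

end LargeTime

end Semigroup

/-! ### Choice of constants and the two regimes of `x`. -/

section LowerBound

variable {d : ℕ}

/-- The error term uses up at most half of the main term; `J + 1` keeps the denominator positive
when only `J ≥ 0` is known. -/
theorem mul_mul_le_half_of_le {a E J s : ℝ} (ha : 0 < a) (hE : 0 < E) (hJ : 0 ≤ J) (hs : 0 ≤ s)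
    (h : s ≤ a / (2 * E * (J + 1))) : s * E * J ≤ a / 2 := by
  rw [le_div_iff₀ (by positivity)] at h
  nlinarith [mul_nonneg hs hE.le]

theorem IsSymmetricLevyMeasure.half_le_levyKernel {ν : Measure (EuclideanSpace ℝ (Fin d))}
    (hν : IsSymmetricLevyMeasure ν) (hd : 0 < d) {κ α T L c a J : ℝ}
    (hκ : 0 < κ) (hα : 0 < α) (hT : 0 < T)
    (hlow : ∀ ξ, κ * ((T * ‖ξ‖) ^ α - 1) - L ≤ levyExponent ν ξ)
    (hup : ∀ ξ, T * ‖ξ‖ ≤ 1 → levyExponent ν ξ ≤ c)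
    (ha : a = Real.exp (-c) *
      (volume : Measure (EuclideanSpace ℝ (Fin d))).real (Metric.ball 0 1))
    (hJ : J = ∫ w : EuclideanSpace ℝ (Fin d), ‖w‖ * Real.exp (-κ * ‖w‖ ^ α))
    (hapos : 0 < a) (hJ0 : 0 ≤ J)
    {z : EuclideanSpace ℝ (Fin d)}
    (hz : ‖z‖ / T ≤ a / (2 * Real.exp (L + κ) * (J + 1))) :
    ((2 * Real.pi * T) ^ d)⁻¹ * (a / 2) ≤ levyKernel ν z := by
  refine le_trans ?_ (hν.le_levyKernel_near_zero hd hκ hα hT hlow hup z)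
  rw [← ha, ← hJ]
  have hpi := Real.pi_pos
  gcongr
  have := mul_mul_le_half_of_le hapos (Real.exp_pos (L + κ)) hJ0 (by positivity) hz
  linarith

theorem exists_largeTimeProfile_le_levyKernel (hd : 0 < d) {α β γ c₀ c₁ c : ℝ}
    (hα : 0 < α) (hβ : α ≤ β) (hc₀ : 0 < c₀) (hc₁ : 0 < c₁) (hc : 0 < c) {q : ℝ → ℝ}
    (hq_pos : ∀ s, 0 < s → 0 < q s) :
    ∃ C : ℝ, 0 < C ∧
      ∀ (ν : Measure (EuclideanSpace ℝ (Fin d))) (A : Set (EuclideanSpace ℝ (Fin d))),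
        IsSymmetricLevyMeasure ν →
        (∀ ξ : EuclideanSpace ℝ (Fin d), 1 < ‖ξ‖ → c₀ * ‖ξ‖ ^ α ≤ levyExponent ν ξ) →
        (∀ x ∈ A, x ≠ 0 → ∀ r : ℝ, 0 < r →
          ENNReal.ofReal (c₁ * r ^ γ * ‖x‖ ^ (-α - γ) * q ‖x‖) ≤ ν (Metric.ball x r)) →
        (∀ r : ℝ, 0 < r → ν (Metric.ball 0 r)ᶜ ≤ ENNReal.ofReal (c * r ^ (-β))) →
        (∀ ξ : EuclideanSpace ℝ (Fin d), ‖ξ‖ ≤ 1 →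
          c⁻¹ * ‖ξ‖ ^ β ≤ levyExponent ν ξ ∧ levyExponent ν ξ ≤ c * ‖ξ‖ ^ β) →
        ∀ x ∈ A, ∀ t : ℝ≥0, 1 < t →
          C * largeTimeProfile α β γ q t x ≤ levyKernel (t • ν) x := by
  have hβ0 : 0 < β := hα.trans_le hβ
  have hpi := Real.pi_pos
  set κ := min c⁻¹ c₀ with hκdef
  have hκ : 0 < κ := lt_min (inv_pos.2 hc) hc₀
  -- All constants are fixed before `ν`, `A`, `x` and `t` are introduced, which makes the final
  -- constant uniform; naming them through equations keeps them opaque.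
  obtain ⟨J, hJ⟩ : ∃ J, J = ∫ w : EuclideanSpace ℝ (Fin d), ‖w‖ * Real.exp (-κ * ‖w‖ ^ α) :=
    ⟨_, rfl⟩
  have hJ0 : 0 ≤ J := hJ ▸ integral_nonneg fun w => by positivity
  obtain ⟨a, ha⟩ : ∃ a, a = Real.exp (-c) *
      (volume : Measure (EuclideanSpace ℝ (Fin d))).real (Metric.ball 0 1) := ⟨_, rfl⟩
  have ha0 : 0 < a := by
    have : 0 < (volume : Measure (EuclideanSpace ℝ (Fin d))).real (Metric.ball 0 1) :=
      ENNReal.toReal_pos (Metric.measure_ball_pos _ _ one_pos).ne' measure_ball_lt_top.ne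
    rw [ha]
    positivity
  obtain ⟨ε₀, hε₀⟩ : ∃ ε, ε = a / (2 * Real.exp (0 + κ) * (J + 1)) := ⟨_, rfl⟩
  have hε₀pos : 0 < ε₀ := by rw [hε₀]; positivity
  -- Bound on the mass of `tν` outside radius `ε₀T/2`: the factors `t = T ^ β` and `T ^ (-β)`
  -- cancel.
  obtain ⟨Λ, hΛ⟩ : ∃ Λ, Λ = c * (ε₀ / 2) ^ (-β) := ⟨_, rfl⟩
  have hΛ0 : 0 < Λ := by rw [hΛ]; positivity
  -- The first entry keeps the ball about `x` outside the cutoff radius; the second is the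
  -- near-origin threshold with loss `L = 2Λ`.
  obtain ⟨ε₁, hε₁⟩ : ∃ ε, ε = min (ε₀ / 2) (a / (2 * Real.exp (2 * Λ + κ) * (J + 1))) := ⟨_, rfl⟩
  have hε₁pos : 0 < ε₁ := by rw [hε₁]; positivity
  have hC₁ : 0 < ((2 * Real.pi) ^ d)⁻¹ * (a / 2) := by positivity
  have hC₂ : 0 < Real.exp (-Λ) * (((2 * Real.pi) ^ d)⁻¹ * (a / 2)) * c₁ * ε₁ ^ γ := by positivity
  refine ⟨min (((2 * Real.pi) ^ d)⁻¹ * (a / 2))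
    (Real.exp (-Λ) * (((2 * Real.pi) ^ d)⁻¹ * (a / 2)) * c₁ * ε₁ ^ γ), lt_min hC₁ hC₂, ?_⟩
  intro ν A hν hlarge hjump htail hsmall x hx t ht
  have ht1 : (1 : ℝ) < t := by exact_mod_cast ht
  have ht0 : (0 : ℝ) < t := one_pos.trans ht1
  obtain ⟨T, hTdef⟩ : ∃ T : ℝ, T = (t : ℝ) ^ (1 / β) := ⟨_, rfl⟩
  have hT1 : 1 ≤ T := by
    rw [hTdef]
    exact Real.one_le_rpow ht1.le (by positivity)
  have hT0 : 0 < T := one_pos.trans_le hT1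
  have htT : T ^ β = t := by
    rw [hTdef, ← Real.rpow_mul ht0.le, one_div_mul_cancel hβ0.ne', Real.rpow_one]
  have hTd : (T ^ d)⁻¹ = (t : ℝ) ^ (-(d : ℝ) / β) := by
    rw [hTdef, ← Real.rpow_natCast, ← Real.rpow_mul ht0.le, ← Real.rpow_neg ht0.le]
    congr 1
    ring
  have hlow := le_levyExponent_smul_scaled hα hβ hc₀ hc hlarge (fun ξ hξ => (hsmall ξ hξ).1) hT1 htT
  have hup := levyExponent_smul_scaled_le hβ0 hc (fun ξ hξ => (hsmall ξ hξ).2) hT1 htT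
  have hνt := hν.smul t
  have hprofile : largeTimeProfile α β γ q t x ≤ (t : ℝ) ^ (-(d : ℝ) / β) := by
    unfold largeTimeProfile
    split_ifs
    · exact le_rfl
    · exact min_le_left _ _
  have hscale : ((2 * Real.pi * T) ^ d)⁻¹ * (a / 2)
      = ((2 * Real.pi) ^ d)⁻¹ * (a / 2) * (t : ℝ) ^ (-(d : ℝ) / β) := by
    rw [mul_pow, mul_inv, hTd]
    ring
  have hprofile0 : 0 ≤ largeTimeProfile α β γ q t x := by
    unfold largeTimeProfile
    split_ifs with h0
    · positivity
    · have := hq_pos ‖x‖ (norm_pos_iff.2 h0)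
      positivity
  rcases le_or_gt (‖x‖ / T) ε₀ with hnear | hfar
  · have h1 := hνt.half_le_levyKernel hd (L := 0) hκ hα hT0 (fun ξ => by linarith [hlow ξ]) hup
      ha hJ ha0 hJ0 (z := x) (by rw [← hε₀]; exact hnear)
    rw [hscale] at h1
    refine le_trans ?_ h1
    gcongr
    exact min_le_left _ _
  · have hxT : ε₀ * T < ‖x‖ := (lt_div_iff₀ hT0).1 hfar
    have hx0 : x ≠ 0 := norm_pos_iff.1 (lt_trans (by positivity) hxT)
    have hq := hq_pos ‖x‖ (norm_pos_iff.2 hx0)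
    -- Half of the near-origin radius: since `‖x‖ > ε₀T`, a margin `ε₀T/2` remains for the ball
    -- about `x`.
    obtain ⟨r, hrdef⟩ : ∃ r, r = ε₀ / 2 * T := ⟨_, rfl⟩
    have hr : 0 < r := by rw [hrdef]; positivity
    have htail' : (t • ν).real (Metric.ball 0 r)ᶜ ≤ Λ := by
      have h1 : ν.real (Metric.ball 0 r)ᶜ ≤ c * r ^ (-β) :=
        ENNReal.toReal_le_of_le_ofReal (by positivity) (htail r hr)
      have h2 : (t • ν).real (Metric.ball 0 r)ᶜ = t * ν.real (Metric.ball 0 r)ᶜ := by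
        simp [measureReal_def]
      rw [h2]
      calc (t : ℝ) * ν.real (Metric.ball 0 r)ᶜ ≤ t * (c * r ^ (-β)) := by gcongr
        _ = Λ * (T ^ β * T ^ (-β)) := by
            rw [hrdef, Real.mul_rpow (by positivity) hT0.le, hΛ, htT]
            ring
        _ = Λ := by rw [← Real.rpow_add hT0, add_neg_cancel, Real.rpow_zero, mul_one]
    have hlowr : ∀ ξ, κ * ((T * ‖ξ‖) ^ α - 1) - 2 * Λ
        ≤ levyExponent ((t • ν).restrict (Metric.ball 0 r)) ξ := fun ξ => by
      linarith [hlow ξ, hνt.levyExponent_sub_le_restrict_ball hr ξ]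
    have hupr : ∀ ξ, T * ‖ξ‖ ≤ 1 →
        levyExponent ((t • ν).restrict (Metric.ball 0 r)) ξ ≤ c := fun ξ hξ =>
      (hνt.levyExponent_restrict_ball_le r ξ).trans (hup ξ hξ)
    have hball : Metric.ball x (ε₁ * T) ⊆ (Metric.ball 0 r)ᶜ := by
      intro y hy
      rw [mem_ball_iff_norm] at hy
      have h1 : ε₁ * T ≤ r := by
        rw [hrdef]
        gcongr
        exact hε₁ ▸ min_le_left _ _
      have h2 := norm_le_norm_add_norm_sub' x y
      rw [norm_sub_rev] at h2
      have h3 : r ≤ ‖y‖ := by linarith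
      simpa using h3
    have hi0 : Integrable (levySymbol ((t • ν).restrict (Metric.ball 0 r))) := by
      simpa using (hνt.restrict_ball r).integrable_norm_pow_mul_levySymbol hd hκ hα hT0 hlowr 0
    have hone := hνt.le_levyKernel_of_one_jump hr hi0
      (ρ := ε₁ * T) (b := ((2 * Real.pi * T) ^ d)⁻¹ * (a / 2)) (by positivity)
      (fun z hz => (hνt.restrict_ball r).half_le_levyKernel hd hκ hα hT0 hlowr hupr ha hJ ha0 hJ0
        (by
          rw [div_le_iff₀ hT0]
          refine hz.le.trans ?_
          gcongr
          exact hε₁ ▸ min_le_right _ _)) hball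
    have hmass : t * (c₁ * (ε₁ * T) ^ γ * ‖x‖ ^ (-α - γ) * q ‖x‖)
        ≤ (t • ν).real (Metric.ball x (ε₁ * T)) := by
      have h2 : (t • ν).real (Metric.ball x (ε₁ * T)) = t * ν.real (Metric.ball x (ε₁ * T)) := by
        simp [measureReal_def]
      -- Finiteness is needed to pass from the extended to the real measure, and follows from the
      -- tail bound.
      have hfin : ν (Metric.ball x (ε₁ * T)) ≠ ⊤ :=
        ((measure_mono hball).trans_lt ((htail r hr).trans_lt ENNReal.ofReal_lt_top)).ne
      rw [h2]
      gcongr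
      exact (ENNReal.ofReal_le_iff_le_toReal hfin).1 (hjump x hx hx0 _ (by positivity))
    -- Height `T ^ (-d)` of the small-jump density, times the intensity `t`, times `T ^ γ` from the
    -- ball radius.
    have htime : (T ^ d)⁻¹ * (t * T ^ γ) = (t : ℝ) ^ (1 + (γ - d) / β) := by
      rw [hTd, hTdef, ← Real.rpow_mul ht0.le]
      conv_lhs => rw [← Real.rpow_one (t : ℝ), ← Real.rpow_mul ht0.le, ← Real.rpow_mul ht0.le]
      rw [← Real.rpow_add ht0, ← Real.rpow_add ht0]
      congr 1
      ring
    have hmin : largeTimeProfile α β γ q t x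
        ≤ (t : ℝ) ^ (1 + (γ - d) / β) * ‖x‖ ^ (-α - γ) * q ‖x‖ := by
      rw [largeTimeProfile, if_neg hx0]
      exact min_le_right _ _
    calc _ ≤ Real.exp (-Λ) * (((2 * Real.pi) ^ d)⁻¹ * (a / 2)) * c₁ * ε₁ ^ γ *
          ((t : ℝ) ^ (1 + (γ - d) / β) * ‖x‖ ^ (-α - γ) * q ‖x‖) := by
          gcongr
          exact min_le_right _ _
      _ = Real.exp (-Λ) * (((2 * Real.pi * T) ^ d)⁻¹ * (a / 2) *
          (t * (c₁ * (ε₁ * T) ^ γ * ‖x‖ ^ (-α - γ) * q ‖x‖))) := by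
          rw [← htime, mul_pow, mul_inv, Real.mul_rpow hε₁pos.le hT0.le]
          ring
      _ ≤ Real.exp (-(t • ν).real (Metric.ball 0 r)ᶜ) * (((2 * Real.pi * T) ^ d)⁻¹ * (a / 2) *
          (t • ν).real (Metric.ball x (ε₁ * T))) := by
          gcongr
      _ ≤ _ := hone

end LowerBound

/-! ### The main theorem. -/

theorem theorem4 (d : ℕ) (α β γ : ℝ)
    (hα : 0 < α) (hα2 : α < 2)
    (hβ : α ≤ β) (hβ2 : β ≤ 2)
    (hγ : 1 ≤ γ) (hγd : γ ≤ d)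
    (c₀ c₁ c : ℝ) (hc₀ : 0 < c₀) (hc₁ : 0 < c₁) (hc : 0 < c)
    (q : ℝ → ℝ) (hq_pos : ∀ s, 0 < s → 0 < q s) (hq_bdd : ∃ M, ∀ s, 0 < s → q s ≤ M) :
    ∃ C : ℝ, 0 < C ∧
      ∀ (ν : Measure (EuclideanSpace ℝ (Fin d))) (A : Set (EuclideanSpace ℝ (Fin d))),
        IsSymmetricLevyMeasure ν →
        (∀ ξ : EuclideanSpace ℝ (Fin d), 1 < ‖ξ‖ → c₀ * ‖ξ‖ ^ α ≤ levyExponent ν ξ) →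
        (∀ x ∈ A, x ≠ 0 → ∀ r : ℝ, 0 < r →
          ENNReal.ofReal (c₁ * r ^ γ * ‖x‖ ^ (-α - γ) * q ‖x‖) ≤ ν (Metric.ball x r)) →
        (∀ r : ℝ, 0 < r → ν (Metric.ball 0 r)ᶜ ≤ ENNReal.ofReal (c * r ^ (-β))) →
        (∀ ξ : EuclideanSpace ℝ (Fin d), ‖ξ‖ ≤ 1 →
          c⁻¹ * ‖ξ‖ ^ β ≤ levyExponent ν ξ ∧ levyExponent ν ξ ≤ c * ‖ξ‖ ^ β) →
        (∃ P, IsLevySemigroup ν P) ∧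
        ∀ P, IsLevySemigroup ν P →
          ∃ p, IsSmoothBoundedDensity P p ∧
            ∀ x ∈ A, ∀ t : ℝ≥0, 1 < t → C * largeTimeProfile α β γ q t x ≤ p t x := by
  -- Positive dimension comes from `1 ≤ γ ≤ d`.
  have hd : 0 < d := by
    have : (0 : ℝ) < d := one_pos.trans_le (hγ.trans hγd)
    exact_mod_cast this
  obtain ⟨C, hC, hbound⟩ := exists_largeTimeProfile_le_levyKernel (d := d) (γ := γ) hd hα hβ hc₀
    hc₁ hc hq_pos
  refine ⟨C, hC, fun ν A hν hlarge hjump htail hsmall => ?_⟩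
  have hint : ∀ t : ℝ≥0, 0 < t → ∀ n : ℕ,
      Integrable (fun v => ‖v‖ ^ n * levySymbol (t • ν) v) := fun t ht n =>
    (hν.smul t).integrable_norm_pow_mul_levySymbol hd (mul_pos (NNReal.coe_pos.2 ht) hc₀) hα one_pos
      (le_levyExponent_smul_of_le hα hc₀ hlarge t) n
  refine ⟨hν.exists_isLevySemigroup fun t ht => by simpa using hint t ht 0, fun P hP => ?_⟩
  exact ⟨_, hP.isSmoothBoundedDensity_levyKernel hν hint,
    hbound ν A hν hlarge hjump htail hsmall⟩
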